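/- Let $\mathbb D$ be the open unit disk, let $\frac{\pi}{2}\le\alpha<\pi$ and $a\in[0,1)$. Let $f=h+\overline g$, where $h,g$ are analytic in $\mathbb D$ with $h(0)=g(0)=0$, satisfy $$h(z)+g(z)=\frac{1}{2i\sin\alpha}\log\left(\frac{1+ze^{i\alpha}}{1+ze^{-i\alpha}}\right)\quad(z\in\mathbb D)$$ (the branch of the logarithm that vanishes at $z=0$), and let $f$ have dilatation $\omega=g'/h'$ given by $\omega(z)=\frac{z+a}{1+az}$. Let $$f_0(z)=h_0(z)+\overline{g_0(z)}=\frac{z-\frac12z^2}{(1-z)^2}-\overline{\frac{\frac12z^2}{(1-z)^2}},$$ and let $f_0*f=h_0*h+\overline{g_0*g}$, where $*$ on the right is the Hadamard product $\left(\sum a_nz^n\right)*\left(\sum A_nz^n\right)=\sum a_nA_nz^n$. Then $(1+a)\,(f_0*f)$ belongs to the class $S_H^O$ of harmonic, sense-preserving, univalent functions $F$ in $\mathbb D$ with $F(0)=0$, $F_z(0)=1$, $F_{\bar z}(0)=0$; and $f_0*f$ is convex in the direction of the real axis, i.e. every horizontal line meets $(f_0*f)(\mathbb D)$ in a connected (possibly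 empty) set. -/

import Mathlib

open scoped Nat ComplexConjugate

/-- The open unit disk in the complex plane. -/
def unitDisk : Set ℂ := Metric.ball 0 1

/-- The Wirtinger derivative `f_z = (f_x - i f_y) / 2`. -/
noncomputable def wirtingerZ (f : ℂ → ℂ) (z : ℂ) : ℂ :=
  (fderiv ℝ f z 1 - Complex.I * fderiv ℝ f z Complex.I) / 2

/-- The Wirtinger derivative `f_z̄ = (f_x + i f_y) / 2`. -/
noncomputable def wirtingerZBar (f : ℂ → ℂ) (z : ℂ) : ℂ :=
  (fderiv ℝ f z 1 + Complex.I * fderiv ℝ f z Complex.I) / 2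

/-- The class `S_H^O`: complex-valued harmonic, sense-preserving, univalent functions on the
unit disk, normalized by `f 0 = 0`, `f_z 0 = 1` and `f_z̄ 0 = 0`. Sense-preserving means that the
Jacobian `|f_z|² - |f_z̄|²` is positive on the disk. -/
structure IsSHO (f : ℂ → ℂ) : Prop where
  harmonic : InnerProductSpace.HarmonicOnNhd f unitDisk
  sense_preserving : ∀ z ∈ unitDisk, ‖wirtingerZBar f z‖ < ‖wirtingerZ f z‖
  univalent : Set.InjOn f unitDisk
  map_zero : f 0 = 0
  wirtingerZ_zero : wirtingerZ f 0 = 1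
  wirtingerZBar_zero : wirtingerZBar f 0 = 0

/-- A set is convex in the direction of the real axis if it contains the whole segment between
any two of its points that lie on a common horizontal line. -/
def ConvexInRealDirection (Ω : Set ℂ) : Prop :=
  ∀ w₁ ∈ Ω, ∀ w₂ ∈ Ω, w₁.im = w₂.im → segment ℝ w₁ w₂ ⊆ Ω

/-- The `n`-th Taylor coefficient at the origin. -/
noncomputable def taylorCoeff (h : ℂ → ℂ) (n : ℕ) : ℂ :=
  iteratedDeriv n h 0 / (n ! : ℂ)

/-- The convolution (Hadamard product) `∑ aₙ Aₙ zⁿ` of two functions analytic in the disk. -/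
noncomputable def analyticConv (h H : ℂ → ℂ) (z : ℂ) : ℂ :=
  ∑' n : ℕ, taylorCoeff h n * taylorCoeff H n * z ^ n

/-- The harmonic convolution `h * H + conj (g * G)` of `h + conj g` and `H + conj G`. -/
noncomputable def harmonicConv (h g H G : ℂ → ℂ) (z : ℂ) : ℂ :=
  analyticConv h H z + conj (analyticConv g G z)

/-- The analytic part of the canonical right half-plane mapping `f₀ = h₀ + conj g₀`. -/
noncomputable def canonicalH (z : ℂ) : ℂ := (z - z ^ 2 / 2) / (1 - z) ^ 2

/-- The co-analytic part of the canonical right half-plane mapping `f₀ = h₀ + conj g₀`. -/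
noncomputable def canonicalG (z : ℂ) : ℂ := -((z ^ 2 / 2) / (1 - z) ^ 2)

/-- The conformal map `(1 / (2 i sin α)) log ((1 + z e^{iα}) / (1 + z e^{-iα}))` of the disk onto a
vertical strip. The quotient stays in a half-plane that avoids the negative real axis, so that the
principal logarithm is the analytic branch vanishing at `z = 0`. -/
noncomputable def stripMap (α : ℝ) (z : ℂ) : ℂ :=
  1 / (2 * Complex.I * (Real.sin α : ℂ)) *
    Complex.log ((1 + z * Complex.exp (Complex.I * (α : ℂ))) /
      (1 + z * Complex.exp (-(Complex.I * (α : ℂ)))))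

/-! The Taylor coefficients of `canonicalH` and `canonicalG` turn the convolution into `H + conj G`
with `H = (h + z h')/2` and `G = (g - z g')/2`. Its real part is `Re (H + G)` and its imaginary part
is `Im (H - G)`, so Clunie–Sheil-Small shearing applies once two facts are known.

Sense preservation: with `k = 2 cos α + 1`, `G'/H'` is `z` times a real cubic's reversal over that
cubic, up to sign. The Schur–Cohn form of the cubic is positive definite for `0 ≤ a < 1`, `-1 < k ≤
1`, so `|G'| < |H'|` (`norm_mul_reversed_cubic_lt`).

Horizontal convexity of `H - G`: put `z = ψ w = sin w / sin (α - w)`, where `w = sin α · stripMap α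
z` runs over a vertical strip. There `((H - G) ∘ ψ)'` is a positive multiple of `(1-a)/(1+a) ·
(1-z)/(1+z) + sin (α - 2w) / sin α` (`convNum_sub_mul`, `one_sub_sq_div_quadratic`). Its real part
is bounded below by a positive quantity depending only on `Re w`, so level sets of `Im (H - G)` are
graphs over the base of the strip. `shear_strip` combines both facts. -/

/-! ### Schur–Cohn bound for the dilatation -/

/-- A Schur–Cohn estimate: a real cubic whose Schur–Cohn form is positive definite dominates its
reversal on the unit disk. -/
theorem norm_mul_reversed_cubic_lt {a k : ℝ} (ha : 0 ≤ a) (ha' : a < 1) (hk : -1 < k)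
    (hk' : k ≤ 1) {z : ℂ} (hz : ‖z‖ < 1) :
    ‖z * ((1 - a * k) - 2 * a * k * z - (k + 3 * a) * z ^ 2 - 2 * z ^ 3)‖ <
      ‖2 + (k + 3 * a) * z + 2 * a * k * z ^ 2 + (a * k - 1) * z ^ 3‖ := by
  have hak : a * k < 1 := by nlinarith
  set N : ℂ := (1 - a * k) - 2 * a * k * z - (k + 3 * a) * z ^ 2 - 2 * z ^ 3 with hN
  set M : ℂ := 2 + (k + 3 * a) * z + 2 * a * k * z ^ 2 + (a * k - 1) * z ^ 3 with hM
  have hr : Complex.normSq z < 1 := by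
    rw [Complex.normSq_eq_norm_sq]; nlinarith [norm_nonneg z]
  obtain ⟨x, y⟩ := z
  have hr' : x ^ 2 + y ^ 2 < 1 := by
    simpa [Complex.normSq_apply, sq] using hr
  -- `(‖M‖² - ‖N‖²)/(1 - |z|²)` is a form in `(1, z, z²)` with a real matrix symmetric about both
  -- diagonals, so it splits into an antisymmetric and a symmetric block. `A`, `√2 B`, `C` are the
  -- entries of the symmetric block.
  set A : ℝ := 4 - (1 - a * k) ^ 2 + (4 * a * k + (1 - a * k) * (k + 3 * a)) with hA
  set B : ℝ := 2 * (k + 3 * a) + 2 * a * k * (1 - a * k) with hB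
  set C : ℝ := 4 - (1 - a * k) ^ 2 + (k + 3 * a) ^ 2 - 4 * a ^ 2 * k ^ 2 with hC
  have hApos : 0 < A := by
    have : A = (1 - k) * (1 - a) ^ 2 + (1 + k) * (2 + 2 * a + 2 * a * (1 - a)) +
        a * (1 + a) * ((1 - k) * (1 + k)) := by
      rw [hA]; ring
    rw [this]
    have h1 : 0 ≤ 1 - k := by linarith
    have h2 : 0 < 1 + k := by linarith
    have h3 : 0 < 1 - a := by linarith
    positivity
  have hdet : A * C - 2 * B ^ 2 =
      (1 + k) * (1 + 3 * a) * (1 - a) ^ 2 * (3 - k) ^ 2 * (1 - a * k) := by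
    rw [hA, hB, hC]; ring
  have hdet_pos : 0 < A * C - 2 * B ^ 2 := by
    rw [hdet]
    have h1 : 0 < 1 + k := by linarith
    have h2 : 0 < 1 - a := by linarith
    have h3 : 0 < 3 - k := by linarith
    have h4 : 0 < 1 - a * k := by linarith
    positivity
  have hE : 0 < (1 - a) * (3 - k) * (1 - a * k) :=
    mul_pos (mul_pos (by linarith) (by linarith)) (by linarith)
  -- The three terms are multiples of `|z² - 1|²` (antisymmetric block) and, from completing the
  -- square in the symmetric block, `|A(z² + 1) + 2Bz|²` and the determinant times `|z|²`.
  have hform : 2 * A * (Complex.normSq M - Complex.normSq N) = (1 - (x ^ 2 + y ^ 2)) *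
      (A * ((1 - a) * (3 - k) * (1 - a * k)) * ((x ^ 2 - y ^ 2 - 1) ^ 2 + (2 * x * y) ^ 2) +
        (A * (x ^ 2 - y ^ 2 + 1) + 2 * B * x) ^ 2 + (A * (2 * x * y) + 2 * B * y) ^ 2 +
        2 * (A * C - 2 * B ^ 2) * (x ^ 2 + y ^ 2)) := by
    rw [hM, hN, hA, hB, hC]
    simp only [Complex.normSq_apply, pow_succ, pow_zero, one_mul, Complex.add_re, Complex.add_im,
      Complex.sub_re, Complex.sub_im, Complex.mul_re, Complex.mul_im, Complex.ofReal_re,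
      Complex.ofReal_im, Complex.one_re, Complex.one_im, Complex.re_ofNat, Complex.im_ofNat]
    ring
  have hne : 0 < (x ^ 2 - y ^ 2 - 1) ^ 2 + (2 * x * y) ^ 2 := by
    have : x ^ 2 - y ^ 2 - 1 < 0 := by linarith [sq_nonneg y]
    exact add_pos_of_pos_of_nonneg (sq_pos_of_neg this) (sq_nonneg _)
  have hpos : 0 < 2 * A * (Complex.normSq M - Complex.normSq N) := by
    rw [hform]
    clear_value A B C
    have : 0 < 1 - (x ^ 2 + y ^ 2) := by linarith
    positivity
  have hlt : ‖N‖ < ‖M‖ := by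
    have h1 : 0 < Complex.normSq M - Complex.normSq N := by
      exact pos_of_mul_pos_right hpos (by positivity)
    rw [Complex.normSq_eq_norm_sq, Complex.normSq_eq_norm_sq] at h1
    exact lt_of_pow_lt_pow_left₀ 2 (norm_nonneg _) (by linarith)
  rw [norm_mul]
  calc _ ≤ 1 * ‖N‖ := by gcongr
    _ < ‖M‖ := by simpa using hlt

/-! ### Shearing on a vertical strip -/

/-- A holomorphic function on a convex open set whose derivative has positive real part is
injective (Noshiro–Warschawski). -/
theorem injOn_of_re_deriv_pos {S : Set ℂ} (hS : Convex ℝ S) {P P' : ℂ → ℂ}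
    (hP : ∀ w ∈ S, HasDerivAt P (P' w) w) (hpos : ∀ w ∈ S, 0 < (P' w).re) : Set.InjOn P S := by
  intro u hu v hv huv
  by_contra hne
  have hne' : v - u ≠ 0 := sub_ne_zero.2 (Ne.symm hne)
  have hline : ∀ t ∈ Set.Icc (0 : ℝ) 1, u + t * (v - u) ∈ S := fun t ht => by
    have := hS.add_smul_sub_mem hu hv ht
    simpa using this
  -- Dividing by `v - u` makes the derivative along the segment exactly `P'`.
  have hd : ∀ t ∈ Set.Icc (0 : ℝ) 1,
      HasDerivAt (fun t : ℝ => (P (u + t * (v - u)) / (v - u)).re)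
        (P' (u + t * (v - u))).re t := by
    intro t ht
    have h1 : HasDerivAt (fun t : ℂ => u + t * (v - u)) (v - u) t := by
      simpa using ((hasDerivAt_id (t : ℂ)).mul_const (v - u)).const_add u
    have h2 := ((hP _ (hline t ht)).comp (t : ℂ) h1).div_const (v - u)
    rw [mul_div_cancel_right₀ _ hne'] at h2
    exact h2.real_of_complex
  have hmono : StrictMonoOn (fun t : ℝ => (P (u + t * (v - u)) / (v - u)).re)
      (Set.Icc 0 1) := by
    refine strictMonoOn_of_deriv_pos (convex_Icc 0 1)
      (fun t ht => (hd t ht).continuousAt.continuousWithinAt) fun t ht => ?_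
    rw [interior_Icc] at ht
    rw [(hd t (Set.Ioo_subset_Icc_self ht)).deriv]
    exact hpos _ (hline t (Set.Ioo_subset_Icc_self ht))
  have := hmono (Set.left_mem_Icc.2 zero_le_one) (Set.right_mem_Icc.2 zero_le_one) one_pos
  simp [huv] at this

/-- If `∂V/∂y` is bounded below by a positive constant on each vertical line of a strip, then each
level set of `V` is a continuous graph over the base interval. -/
theorem exists_continuousOn_graph_level {x₁ x₂ : ℝ} {V : ℝ → ℝ → ℝ} {V' : ℝ → ℝ → ℝ} {δ : ℝ → ℝ}
    (hV : ∀ x ∈ Set.Ioo x₁ x₂, ∀ y, HasDerivAt (V x) (V' x y) y)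
    (hδ : ∀ x ∈ Set.Ioo x₁ x₂, 0 < δ x) (hV' : ∀ x ∈ Set.Ioo x₁ x₂, ∀ y, δ x ≤ V' x y)
    (hcont : ∀ y, ContinuousOn (fun x => V x y) (Set.Ioo x₁ x₂)) (t : ℝ) :
    ∃ Y : ℝ → ℝ, ContinuousOn Y (Set.Ioo x₁ x₂) ∧
      ∀ x ∈ Set.Ioo x₁ x₂, ∀ y, V x y = t ↔ y = Y x := by
  have hmono : ∀ x ∈ Set.Ioo x₁ x₂, StrictMono (V x) := fun x hx =>
    strictMono_of_deriv_pos fun y => by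
      rw [(hV x hx y).deriv]; exact (hδ x hx).trans_le (hV' x hx y)
  have hlower : ∀ x ∈ Set.Ioo x₁ x₂, ∀ y y', y ≤ y' → δ x * (y' - y) ≤ V x y' - V x y :=
    fun x hx y y' hy => mul_sub_le_image_sub_of_le_deriv
      (fun y => (hV x hx y).differentiableAt)
      (fun y => by rw [(hV x hx y).deriv]; exact hV' x hx y) hy
  have hex : ∀ x, ∃ y, x ∈ Set.Ioo x₁ x₂ → V x y = t := by
    intro x
    by_cases hx : x ∈ Set.Ioo x₁ x₂
    · have hc : Continuous (V x) := continuous_iff_continuousAt.2 fun y => (hV x hx y).continuousAt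
      have hd := hδ x hx
      -- At slope at least `δ x`, moving by `r` from `0` suffices to reach `t`.
      set r := |t - V x 0| / δ x with hr
      have hr0 : 0 ≤ r := by positivity
      have hrd : δ x * r = |t - V x 0| := by rw [hr]; field_simp
      have h1 := hlower x hx 0 r hr0
      have h2 := hlower x hx (-r) 0 (by linarith)
      have h3 := le_abs_self (t - V x 0)
      have h4 := neg_abs_le (t - V x 0)
      obtain ⟨y, -, hy⟩ := intermediate_value_Icc (by linarith : -r ≤ r) hc.continuousOn
        (⟨by linarith, by linarith⟩ : t ∈ Set.Icc (V x (-r)) (V x r))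
      exact ⟨y, fun _ => hy⟩
    · exact ⟨0, fun h => absurd h hx⟩
  choose Y hY using hex
  refine ⟨Y, fun x hx => ?_, fun x hx y => ⟨fun h => ?_, fun h => h ▸ hY x hx⟩⟩
  · refine ContinuousAt.continuousWithinAt ?_
    have hnhds := Ioo_mem_nhds hx.1 hx.2
    rw [Metric.continuousAt_iff']
    intro ε hε
    have hlt : V x (Y x - ε) < t := by
      rw [← hY x hx]; exact hmono x hx (by linarith)
    have hgt : t < V x (Y x + ε) := by
      conv_lhs => rw [← hY x hx]
      exact hmono x hx (by linarith)
    -- The values of `V` at heights `Y x ± ε` still straddle `t` for nearby abscissae, which traps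
    -- `Y` by monotonicity.
    filter_upwards [hnhds, ((hcont (Y x - ε)).continuousAt hnhds).eventually_lt_const hlt,
      ((hcont (Y x + ε)).continuousAt hnhds).eventually_const_lt hgt] with u hu h1 h2
    rw [← hY u hu] at h1 h2
    have h1 := (hmono u hu).lt_iff_lt.1 h1
    have h2 := (hmono u hu).lt_iff_lt.1 h2
    rw [Real.dist_eq, abs_lt]
    exact ⟨by linarith, by linarith⟩
  · exact (hmono x hx).injective (h.trans (hY x hx).symm)

/-- A holomorphic function on a vertical strip whose derivative has real part bounded below by a
positive constant on each vertical line has horizontally convex image. -/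
theorem exists_re_eq_of_mem_uIcc {x₁ x₂ : ℝ} {P P' : ℂ → ℂ} {δ : ℝ → ℝ}
    (hP : ∀ w : ℂ, w.re ∈ Set.Ioo x₁ x₂ → HasDerivAt P (P' w) w)
    (hδ : ∀ x ∈ Set.Ioo x₁ x₂, 0 < δ x)
    (hP' : ∀ w : ℂ, w.re ∈ Set.Ioo x₁ x₂ → δ w.re ≤ (P' w).re)
    {u v : ℂ} (hu : u.re ∈ Set.Ioo x₁ x₂) (hv : v.re ∈ Set.Ioo x₁ x₂)
    (huv : (P u).im = (P v).im) {r : ℝ} (hr : r ∈ Set.uIcc (P u).re (P v).re) :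
    ∃ w : ℂ, w.re ∈ Set.Ioo x₁ x₂ ∧ P w = ⟨r, (P u).im⟩ := by
  have hcontP : ∀ w : ℂ, w.re ∈ Set.Ioo x₁ x₂ → ContinuousAt P w :=
    fun w hw => (hP w hw).continuousAt
  obtain ⟨Y, hYc, hY⟩ := exists_continuousOn_graph_level (x₁ := x₁) (x₂ := x₂)
    (V := fun x y => (P ⟨x, y⟩).im) (V' := fun x y => (P' ⟨x, y⟩).re) (δ := δ)
    (fun x hx y => by
      have h1 : HasDerivAt (fun y : ℂ => (x : ℂ) + y * Complex.I) Complex.I y := by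
        simpa using ((hasDerivAt_id (y : ℂ)).mul_const Complex.I).const_add (x : ℂ)
      have hmem : ((x : ℂ) + y * Complex.I).re ∈ Set.Ioo x₁ x₂ := by simpa using hx
      -- `Im P = Re (-i P)`, and the factor `-i` cancels the `i` from the vertical direction.
      have h2 := (((hP _ hmem).comp (y : ℂ) h1).mul_const (-Complex.I)).real_of_complex
      convert! h2 using 1
      · funext y
        simp [Complex.mk_eq_add_mul_I]
      · rw [mul_assoc]
        simp [Complex.mk_eq_add_mul_I])
    hδ (fun x hx y => hP' ⟨x, y⟩ hx)
    (fun y x hx => by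
      have h1 : ContinuousAt (fun x : ℝ => (⟨x, y⟩ : ℂ)) x := by
        simp only [Complex.mk_eq_add_mul_I]; fun_prop
      exact (Complex.continuous_im.continuousAt.comp
        (ContinuousAt.comp (f := fun x : ℝ => (⟨x, y⟩ : ℂ)) (hcontP ⟨x, y⟩ hx)
          h1)).continuousWithinAt)
    (P u).im
  have hsub : Set.uIcc u.re v.re ⊆ Set.Ioo x₁ x₂ := Set.OrdConnected.uIcc_subset inferInstance hu hv
  have hYu : (⟨u.re, Y u.re⟩ : ℂ) = u := by
    rw [← (hY u.re hu u.im).1 rfl]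
  have hYv : (⟨v.re, Y v.re⟩ : ℂ) = v := by
    rw [← (hY v.re hv v.im).1 huv.symm]
  have hc : ContinuousOn (fun x => (P ⟨x, Y x⟩).re) (Set.uIcc u.re v.re) := by
    intro x hx
    have h1 : ContinuousWithinAt (fun x => (⟨x, Y x⟩ : ℂ)) (Set.uIcc u.re v.re) x := by
      have := (hYc x (hsub hx)).mono hsub
      simp only [Complex.mk_eq_add_mul_I]
      have h2 := (Complex.continuous_ofReal.continuousAt.comp_continuousWithinAt this)
      exact Complex.continuous_ofReal.continuousWithinAt.add (h2.mul continuousWithinAt_const)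
    exact Complex.continuous_re.continuousAt.comp_continuousWithinAt
      (ContinuousAt.comp_continuousWithinAt (f := fun x => (⟨x, Y x⟩ : ℂ))
        (hcontP ⟨x, Y x⟩ (hsub hx)) h1)
  have := intermediate_value_uIcc hc
  simp only [hYu, hYv] at this
  obtain ⟨x, hx, hxr⟩ := this hr
  exact ⟨⟨x, Y x⟩, hsub hx, Complex.ext hxr ((hY x (hsub hx) (Y x)).2 rfl)⟩

/-- The shear construction on a vertical strip: let `P`, `Q` be holomorphic with `Re P'` bounded
below by a positive constant on each vertical line and `Re (Q' / P') > 0`. Then `Re Q + i Im P` is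
univalent and its image is convex in the direction of the real axis. -/
theorem shear_strip {x₁ x₂ : ℝ} {P P' Q Q' : ℂ → ℂ} {δ : ℝ → ℝ}
    (hP : ∀ w : ℂ, w.re ∈ Set.Ioo x₁ x₂ → HasDerivAt P (P' w) w)
    (hQ : ∀ w : ℂ, w.re ∈ Set.Ioo x₁ x₂ → HasDerivAt Q (Q' w) w)
    (hδ : ∀ x ∈ Set.Ioo x₁ x₂, 0 < δ x)
    (hP' : ∀ w : ℂ, w.re ∈ Set.Ioo x₁ x₂ → δ w.re ≤ (P' w).re)
    (hQP : ∀ w : ℂ, w.re ∈ Set.Ioo x₁ x₂ → 0 < (Q' w / P' w).re) :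
    Set.InjOn (fun w => (⟨(Q w).re, (P w).im⟩ : ℂ)) (Complex.re ⁻¹' Set.Ioo x₁ x₂) ∧
      ConvexInRealDirection
        ((fun w => (⟨(Q w).re, (P w).im⟩ : ℂ)) '' (Complex.re ⁻¹' Set.Ioo x₁ x₂)) := by
  set S : Set ℂ := Complex.re ⁻¹' Set.Ioo x₁ x₂
  have hSconv : Convex ℝ S := (convex_Ioo x₁ x₂).linear_preimage Complex.reLm
  have hSopen : IsOpen S := isOpen_Ioo.preimage Complex.continuous_re
  have hpos : ∀ w ∈ S, 0 < (P' w).re := fun w hw => (hδ _ hw).trans_le (hP' w hw)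
  have hinj : Set.InjOn P S := injOn_of_re_deriv_pos hSconv hP hpos
  -- In the coordinate `p = P w` the map is `p ↦ Re (Q ∘ P⁻¹) + i Im p`: it fixes heights and, as
  -- `Re (Q'/P') > 0`, is increasing on each horizontal slice of `P(S)`, which is an interval.
  set G := Function.invFunOn P S
  have hGP : ∀ w ∈ S, G (P w) = w := fun w hw => hinj.leftInvOn_invFunOn hw
  have hR : ∀ w ∈ S, HasDerivAt (fun p => Q (G p)) (Q' w / P' w) (P w) := by
    intro w hw
    have hne : P' w ≠ 0 := fun h => by simpa [h] using hpos w hw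
    have hstrict : HasStrictDerivAt P (P' w) w := by
      have han : AnalyticAt ℂ P w := DifferentiableOn.analyticAt
        (fun u hu => (hP u hu).differentiableAt.differentiableWithinAt) (hSopen.mem_nhds hw)
      simpa [(hP w hw).deriv] using han.hasStrictDerivAt
    have hg := (hstrict.to_local_left_inverse hne (g := G)
      (by filter_upwards [hSopen.mem_nhds hw] with u hu using hGP u hu)).hasDerivAt
    have hq : HasDerivAt Q (Q' w) (G (P w)) := by rw [hGP w hw]; exact hQ w hw
    rw [div_eq_mul_inv]
    exact hq.comp (P w) hg
  have hline : ∀ u ∈ S, ∀ v ∈ S, (P u).im = (P v).im → ∀ r ∈ Set.uIcc (P u).re (P v).re,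
      ∃ w ∈ S, P w = ⟨r, (P u).im⟩ := fun u hu v hv huv r hr =>
    exists_re_eq_of_mem_uIcc hP hδ hP' hu hv huv hr
  have hRline : ∀ u ∈ S, ∀ v ∈ S, (P u).im = (P v).im → ∀ r ∈ Set.uIcc (P u).re (P v).re,
      ∃ d > 0, HasDerivAt (fun r : ℝ => (Q (G ⟨r, (P u).im⟩)).re) d r := by
    intro u hu v hv huv r hr
    obtain ⟨w, hw, hwr⟩ := hline u hu v hv huv r hr
    refine ⟨_, hQP w hw, ?_⟩
    have h1 : HasDerivAt (fun r : ℂ => r + (P u).im * Complex.I) 1 r :=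
      (hasDerivAt_id (r : ℂ)).add_const _
    have h0 := hR w hw
    rw [hwr, Complex.mk_eq_add_mul_I] at h0
    have h2 := (h0.comp (r : ℂ) h1).real_of_complex
    simpa [Complex.mk_eq_add_mul_I] using h2
  have hRcont : ∀ u ∈ S, ∀ v ∈ S, (P u).im = (P v).im →
      ContinuousOn (fun r : ℝ => (Q (G ⟨r, (P u).im⟩)).re) (Set.uIcc (P u).re (P v).re) :=
    fun u hu v hv huv r hr => by
      obtain ⟨d, -, hd⟩ := hRline u hu v hv huv r hr
      exact hd.continuousAt.continuousWithinAt
  have hval : ∀ u ∈ S, (Q (G ⟨(P u).re, (P u).im⟩)).re = (Q u).re := fun u hu => by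
    rw [Complex.eta, hGP u hu]
  have hlt : ∀ u ∈ S, ∀ v ∈ S, (P u).im = (P v).im → (P u).re < (P v).re →
      (Q u).re < (Q v).re := by
    intro u hu v hv huv hre
    have hmono : StrictMonoOn (fun r : ℝ => (Q (G ⟨r, (P u).im⟩)).re)
        (Set.uIcc (P u).re (P v).re) := by
      refine strictMonoOn_of_deriv_pos (convex_uIcc _ _) (hRcont u hu v hv huv) fun r hr => ?_
      obtain ⟨d, hd0, hd⟩ := hRline u hu v hv huv r (interior_subset hr)
      rwa [hd.deriv]
    have := hmono Set.left_mem_uIcc Set.right_mem_uIcc hre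
    simp only [hval u hu] at this
    rwa [huv, hval v hv] at this
  refine ⟨fun u hu v hv huv => ?_, ?_⟩
  · obtain ⟨h1, h2⟩ := Complex.mk.inj huv
    rcases lt_trichotomy (P u).re (P v).re with h | h | h
    · exact absurd h1 (hlt u hu v hv h2 h).ne
    · exact hinj hu hv (Complex.ext h h2)
    · exact absurd h1.symm (hlt v hv u hu h2.symm h).ne
  · rintro _ ⟨u, hu, rfl⟩ _ ⟨v, hv, rfl⟩ him z hz
    have him' : (P u).im = (P v).im := him
    have hzre : z.re ∈ Set.uIcc (Q u).re (Q v).re := by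
      rw [← segment_eq_uIcc]
      have := Set.mem_image_of_mem Complex.reLm hz
      rwa [← LinearMap.coe_toAffineMap, image_segment] at this
    have hzim : z.im = (P u).im := by
      have := Set.mem_image_of_mem Complex.imLm hz
      rw [← LinearMap.coe_toAffineMap, image_segment] at this
      simpa [him'] using this
    have hivt := intermediate_value_uIcc (hRcont u hu v hv him')
    simp only [hval u hu] at hivt
    rw [show (Q (G ⟨(P v).re, (P u).im⟩)).re = (Q v).re by rw [him', hval v hv]] at hivt
    obtain ⟨r, hr, hrz⟩ := hivt hzre
    obtain ⟨w, hw, hwr⟩ := hline u hu v hv him' r hr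
    refine ⟨w, hw, Complex.ext ?_ ?_⟩
    · simp only at hrz ⊢
      rw [← hrz, ← hwr, hGP w hw]
    · simp [hwr, hzim]

/-! ### Convolution with the half-plane mapping -/

theorem taylorCoeff_eq_of_hasSum {f : ℂ → ℂ} {c : ℕ → ℂ}
    (hf : ∀ z ∈ unitDisk, HasSum (fun n => c n * z ^ n) (f z)) (n : ℕ) :
    taylorCoeff f n = c n := by
  have h1 : HasFPowerSeriesAt f (FormalMultilinearSeries.ofScalars ℂ c) 0 := by
    rw [hasFPowerSeriesAt_iff]
    filter_upwards [Metric.ball_mem_nhds (0 : ℂ) one_pos] with z hz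
    simpa [FormalMultilinearSeries.coeff_ofScalars, mul_comm] using hf z hz
  have h2 := h1.analyticAt.hasFPowerSeriesAt
  have := congr_arg (FormalMultilinearSeries.coeff · n) (h1.eq_formalMultilinearSeries h2)
  simp [FormalMultilinearSeries.coeff_ofScalars] at this
  rw [this, taylorCoeff]

theorem hasSum_taylorCoeff {f : ℂ → ℂ} (hf : DifferentiableOn ℂ f unitDisk) {z : ℂ}
    (hz : z ∈ unitDisk) : HasSum (fun n => taylorCoeff f n * z ^ n) (f z) := by
  have := Complex.hasSum_taylorSeries_on_ball hf hz
  convert! this using 2 with n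
  simp [taylorCoeff]
  ring

theorem hasSum_natCast_mul_taylorCoeff {f : ℂ → ℂ} (hf : DifferentiableOn ℂ f unitDisk) {z : ℂ}
    (hz : z ∈ unitDisk) :
    HasSum (fun n : ℕ => n * taylorCoeff f n * z ^ n) (z * deriv f z) := by
  have h1 := (hasSum_taylorCoeff (hf.deriv Metric.isOpen_ball) hz).mul_left z
  rw [← hasSum_nat_add_iff' 1]
  simp only [Finset.range_one, Finset.sum_singleton, Nat.cast_zero, zero_mul, sub_zero]
  convert! h1 using 2 with n
  rw [taylorCoeff, taylorCoeff, iteratedDeriv_succ', Nat.factorial_succ]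
  have : (n ! : ℂ) ≠ 0 := by exact_mod_cast n.factorial_ne_zero
  have : (n + 1 : ℂ) ≠ 0 := by exact_mod_cast n.succ_ne_zero
  push_cast
  field_simp
  ring

theorem one_sub_ne_zero_of_mem_unitDisk {z : ℂ} (hz : z ∈ unitDisk) : 1 - z ≠ 0 := by
  intro h
  have : ‖z‖ < 1 := by simpa [unitDisk] using hz
  rw [← sub_eq_zero.1 h] at this
  simp at this

theorem hasSum_canonicalH {z : ℂ} (hz : z ∈ unitDisk) :
    HasSum (fun n : ℕ => (if n = 0 then 0 else (n + 1) / 2 : ℂ) * z ^ n) (canonicalH z) := by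
  have hz' : ‖z‖ < 1 := by simpa [unitDisk] using hz
  have h0 := one_sub_ne_zero_of_mem_unitDisk hz
  have h1 := ((hasSum_coe_mul_geometric_of_norm_lt_one hz').add
    (hasSum_geometric_of_norm_lt_one hz')).div_const 2
  have h2 := h1.sub (hasSum_ite_eq 0 (1 / 2 : ℂ))
  convert! h2 using 1
  · funext n
    rcases n with _ | n
    · simp
    · simp; ring
  · rw [canonicalH]; field_simp; ring

theorem hasSum_canonicalG {z : ℂ} (hz : z ∈ unitDisk) :
    HasSum (fun n : ℕ => (if n = 0 then 0 else (1 - n) / 2 : ℂ) * z ^ n) (canonicalG z) := by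
  have hz' : ‖z‖ < 1 := by simpa [unitDisk] using hz
  have h0 := one_sub_ne_zero_of_mem_unitDisk hz
  have h1 := ((hasSum_geometric_of_norm_lt_one hz').sub
    (hasSum_coe_mul_geometric_of_norm_lt_one hz')).div_const 2
  have h2 := h1.sub (hasSum_ite_eq 0 (1 / 2 : ℂ))
  convert! h2 using 1
  · funext n
    rcases n with _ | n
    · simp
    · simp; ring
  · rw [canonicalG]; field_simp; ring

theorem taylorCoeff_zero {f : ℂ → ℂ} (h0 : f 0 = 0) : taylorCoeff f 0 = 0 := by
  simp [taylorCoeff, h0]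

/-- The multiplier `(n + 1)/2` is half the identity plus half the Euler operator `z d/dz`. It is
replaced by `0` at `n = 0`, which is harmless because `h 0 = 0`. -/
theorem analyticConv_canonicalH {h : ℂ → ℂ} (hh : DifferentiableOn ℂ h unitDisk) (h0 : h 0 = 0)
    {z : ℂ} (hz : z ∈ unitDisk) :
    analyticConv canonicalH h z = (h z + z * deriv h z) / 2 := by
  have h1 := ((hasSum_taylorCoeff hh hz).add (hasSum_natCast_mul_taylorCoeff hh hz)).div_const 2
  rw [analyticConv, ← h1.tsum_eq]
  refine tsum_congr fun n => ?_
  rw [taylorCoeff_eq_of_hasSum (fun _ => hasSum_canonicalH)]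
  rcases n with _ | n
  · simp [taylorCoeff_zero h0]
  · simp; ring

theorem analyticConv_canonicalG {g : ℂ → ℂ} (hg : DifferentiableOn ℂ g unitDisk) (g0 : g 0 = 0)
    {z : ℂ} (hz : z ∈ unitDisk) :
    analyticConv canonicalG g z = (g z - z * deriv g z) / 2 := by
  have h1 := ((hasSum_taylorCoeff hg hz).sub (hasSum_natCast_mul_taylorCoeff hg hz)).div_const 2
  rw [analyticConv, ← h1.tsum_eq]
  refine tsum_congr fun n => ?_
  rw [taylorCoeff_eq_of_hasSum (fun _ => hasSum_canonicalG)]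
  rcases n with _ | n
  · simp [taylorCoeff_zero g0]
  · simp; ring

/-! ### Half-plane estimates, Wirtinger derivatives and the strip map -/

theorem norm_lt_one_of_mem_unitDisk {z : ℂ} (hz : z ∈ unitDisk) : ‖z‖ < 1 := by
  simpa [unitDisk] using hz

theorem re_one_add_pos {z : ℂ} (hz : ‖z‖ < 1) : 0 < (1 + z).re := by
  have := (abs_lt.1 ((Complex.abs_re_le_norm z).trans_lt hz)).1
  simp only [Complex.add_re, Complex.one_re]
  linarith

theorem one_add_ne_zero_of_norm_lt_one {z : ℂ} (hz : ‖z‖ < 1) : 1 + z ≠ 0 := fun h => by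
  simpa [h] using re_one_add_pos hz

theorem div_mem_slitPlane {A B : ℂ} (hA : 0 < A.re) (hB : 0 < B.re) :
    A / B ∈ Complex.slitPlane := by
  rw [Complex.mem_slitPlane_iff]
  by_contra! h
  have hB0 : B ≠ 0 := fun h => by simp [h] at hB
  have h1 : A / B = ((A / B).re : ℂ) := Complex.ext rfl (by simpa using h.2)
  have h2 : A = ((A / B).re : ℂ) * B := by rw [← h1]; field_simp
  have h3 := congrArg Complex.re h2
  rw [Complex.re_ofReal_mul] at h3
  nlinarith

/-- `Re ((A + B) conj (A - B)) = |A|² - |B|²`. -/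
theorem re_add_div_sub_pos {A B : ℂ} (h : ‖B‖ < ‖A‖) : 0 < ((A + B) / (A - B)).re := by
  have hne : A - B ≠ 0 := fun h0 => by rw [sub_eq_zero.1 h0] at h; exact lt_irrefl _ h
  have h2 : Complex.normSq B < Complex.normSq A := by
    rw [Complex.normSq_eq_norm_sq, Complex.normSq_eq_norm_sq]
    exact pow_lt_pow_left₀ h (norm_nonneg _) two_ne_zero
  rw [Complex.div_re, ← add_div]
  refine div_pos ?_ (Complex.normSq_pos.2 hne)
  simp only [Complex.normSq_apply, Complex.add_re, Complex.sub_re, Complex.add_im,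
    Complex.sub_im] at h2 ⊢
  linarith

theorem wirtinger_of_eventuallyEq {f H G : ℂ → ℂ} {κ H' G' z : ℂ} (hH : HasDerivAt H H' z)
    (hG : HasDerivAt G G' z) (hf : f =ᶠ[nhds z] fun z => κ * (H z + conj (G z))) :
    wirtingerZ f z = κ * H' ∧ wirtingerZBar f z = κ * conj G' := by
  have h1 := hH.hasFDerivAt.restrictScalars ℝ
  have h2 := (Complex.conjCLE.hasFDerivAt (x := G z)).comp z (hG.hasFDerivAt.restrictScalars ℝ)
  have h3 := ((h1.add h2).const_mul κ).congr_of_eventuallyEq hf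
  rw [wirtingerZ, wirtingerZBar, h3.fderiv]
  constructor
  · simp
    ring_nf
    simp
    ring
  · simp
    ring_nf
    simp
    ring

theorem exp_I_mul_add_exp_neg (α : ℝ) :
    Complex.exp (Complex.I * α) + Complex.exp (-(Complex.I * α)) = 2 * Real.cos α := by
  rw [Complex.ofReal_cos, Complex.cos, mul_comm Complex.I, neg_mul]
  ring

theorem exp_I_mul_sub_exp_neg (α : ℝ) :
    Complex.exp (Complex.I * α) - Complex.exp (-(Complex.I * α)) =
      2 * Complex.I * Real.sin α := by
  rw [Complex.ofReal_sin, Complex.sin, mul_comm Complex.I, neg_mul]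
  linear_combination (Complex.exp (α * Complex.I) - Complex.exp (-(α * Complex.I))) *
    Complex.I_sq

theorem exp_I_mul_mul_exp_neg (α : ℝ) :
    Complex.exp (Complex.I * α) * Complex.exp (-(Complex.I * α)) = 1 := by
  rw [← Complex.exp_add]; simp

theorem one_add_mul_exp_mul (α : ℝ) (z : ℂ) :
    (1 + z * Complex.exp (Complex.I * α)) * (1 + z * Complex.exp (-(Complex.I * α))) =
      1 + 2 * Real.cos α * z + z ^ 2 := by
  linear_combination z * exp_I_mul_add_exp_neg α + z ^ 2 * exp_I_mul_mul_exp_neg α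

theorem norm_mul_exp_I (α : ℝ) (z : ℂ) : ‖z * Complex.exp (Complex.I * α)‖ = ‖z‖ := by
  rw [norm_mul, mul_comm Complex.I, Complex.norm_exp_ofReal_mul_I, mul_one]

theorem norm_mul_exp_neg_I (α : ℝ) (z : ℂ) : ‖z * Complex.exp (-(Complex.I * α))‖ = ‖z‖ := by
  have := norm_mul_exp_I (-α) z
  rwa [Complex.ofReal_neg, mul_neg] at this

theorem quadratic_ne_zero (α : ℝ) {z : ℂ} (hz : ‖z‖ < 1) :
    1 + 2 * (Real.cos α : ℂ) * z + z ^ 2 ≠ 0 := by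
  rw [← one_add_mul_exp_mul]
  exact mul_ne_zero (one_add_ne_zero_of_norm_lt_one (by rwa [norm_mul_exp_I]))
    (one_add_ne_zero_of_norm_lt_one (by rwa [norm_mul_exp_neg_I]))

theorem strip_quotient_mem_slitPlane (α : ℝ) {z : ℂ} (hz : ‖z‖ < 1) :
    (1 + z * Complex.exp (Complex.I * α)) / (1 + z * Complex.exp (-(Complex.I * α))) ∈
      Complex.slitPlane :=
  div_mem_slitPlane (re_one_add_pos (by rwa [norm_mul_exp_I]))
    (re_one_add_pos (by rwa [norm_mul_exp_neg_I]))

theorem hasDerivAt_stripMap {α : ℝ} (hα : Real.sin α ≠ 0) {z : ℂ} (hz : ‖z‖ < 1) :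
    HasDerivAt (stripMap α) (1 / (1 + 2 * (Real.cos α : ℂ) * z + z ^ 2)) z := by
  have hs : (Real.sin α : ℂ) ≠ 0 := by exact_mod_cast hα
  have hA := one_add_ne_zero_of_norm_lt_one (z := z * Complex.exp (Complex.I * α))
    (by rwa [norm_mul_exp_I])
  have hB := one_add_ne_zero_of_norm_lt_one (z := z * Complex.exp (-(Complex.I * α)))
    (by rwa [norm_mul_exp_neg_I])
  have hlin : ∀ e : ℂ, HasDerivAt (fun z : ℂ => 1 + z * e) e z := fun e => by
    simpa using ((hasDerivAt_id z).mul_const e).const_add 1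
  have h := (((hlin _).div (hlin _) hB).clog (strip_quotient_mem_slitPlane α hz)).const_mul
    (1 / (2 * Complex.I * (Real.sin α : ℂ)))
  convert! h using 1
  rw [← one_add_mul_exp_mul]
  have hd := exp_I_mul_sub_exp_neg α
  simp only [Pi.div_apply]
  field_simp
  linear_combination -hd

/-! ### Parametrizing the disk by the strip -/

section Parametrization

theorem sin_eq_ofReal_add_ofReal_mul_I (w : ℂ) :
    Complex.sin w = ((Real.sin w.re * Real.cosh w.im : ℝ) : ℂ) +
      ((Real.cos w.re * Real.sinh w.im : ℝ) : ℂ) * Complex.I := by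
  rw [Complex.sin_eq]; push_cast; rfl

theorem normSq_sin (w : ℂ) :
    Complex.normSq (Complex.sin w) = Real.sin w.re ^ 2 + Real.sinh w.im ^ 2 := by
  rw [sin_eq_ofReal_add_ofReal_mul_I, Complex.normSq_add_mul_I]
  linear_combination (Real.sin w.re ^ 2) * Real.cosh_sq w.im +
    Real.sinh w.im ^ 2 * Real.sin_sq_add_cos_sq w.re

/-- The `sinh` terms cancel, so whether `|sin w / sin (α - w)| < 1` depends on `Re w` alone; this is
why a vertical strip corresponds to the disk. -/
theorem normSq_sin_sub (α : ℝ) (w : ℂ) :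
    Complex.normSq (Complex.sin (α - w)) - Complex.normSq (Complex.sin w) =
      Real.sin α * Real.sin (α - 2 * w.re) := by
  rw [normSq_sin, normSq_sin]
  have h1 : Real.sin α = Real.sin (α - w.re) * Real.cos w.re +
      Real.cos (α - w.re) * Real.sin w.re := by
    rw [← Real.sin_add]; ring_nf
  have h2 : Real.sin (α - 2 * w.re) = Real.sin (α - w.re) * Real.cos w.re -
      Real.cos (α - w.re) * Real.sin w.re := by
    rw [← Real.sin_sub]; ring_nf
  rw [h1, h2]
  simp only [Complex.sub_re, Complex.ofReal_re, Complex.sub_im, Complex.ofReal_im, zero_sub,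
    Real.sinh_neg]
  have e1 := Real.sin_sq_add_cos_sq (α - w.re)
  have e2 := Real.sin_sq_add_cos_sq w.re
  linear_combination -Real.sin (α - w.re) ^ 2 * e2 + Real.sin w.re ^ 2 * e1

variable {α : ℝ} {w : ℂ}

theorem sin_sub_two_mul_pos (hw : w.re ∈ Set.Ioo ((α - Real.pi) / 2) (α / 2)) :
    0 < Real.sin (α - 2 * w.re) :=
  Real.sin_pos_of_pos_of_lt_pi (by linarith [hw.2]) (by linarith [hw.1])

theorem sin_sub_ne_zero (hα : 0 < Real.sin α)
    (hw : w.re ∈ Set.Ioo ((α - Real.pi) / 2) (α / 2)) : Complex.sin (α - w) ≠ 0 := fun h => by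
  have h1 := normSq_sin_sub α w
  have h2 := mul_pos hα (sin_sub_two_mul_pos hw)
  rw [h, Complex.normSq_zero] at h1
  linarith [Complex.normSq_nonneg (Complex.sin w)]

theorem sin_div_sin_sub_mem_unitDisk (hα : 0 < Real.sin α)
    (hw : w.re ∈ Set.Ioo ((α - Real.pi) / 2) (α / 2)) :
    Complex.sin w / Complex.sin (α - w) ∈ unitDisk := by
  have h1 := normSq_sin_sub α w
  have h2 := mul_pos hα (sin_sub_two_mul_pos hw)
  rw [Complex.normSq_eq_norm_sq, Complex.normSq_eq_norm_sq] at h1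
  have h3 : ‖Complex.sin w‖ < ‖Complex.sin (α - w)‖ :=
    lt_of_pow_lt_pow_left₀ 2 (norm_nonneg _) (by linarith)
  simp only [unitDisk, Metric.mem_ball, dist_zero_right, norm_div]
  exact (div_lt_one (norm_pos_iff.2 (sin_sub_ne_zero hα hw))).2 h3

theorem sin_addition_expansion (α w : ℂ) :
    Complex.sin α = Complex.sin (α - w) * Complex.cos w + Complex.cos (α - w) * Complex.sin w ∧
    Complex.cos α = Complex.cos (α - w) * Complex.cos w - Complex.sin (α - w) * Complex.sin w ∧
    Complex.sin (α - 2 * w) =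
      Complex.sin (α - w) * Complex.cos w - Complex.cos (α - w) * Complex.sin w := by
  refine ⟨?_, ?_, ?_⟩
  · rw [← Complex.sin_add]; ring_nf
  · rw [← Complex.cos_add]; ring_nf
  · rw [← Complex.sin_sub]; ring_nf

theorem quadratic_sin_div_sin_sub (h : Complex.sin (α - w) ≠ 0) :
    1 + 2 * (Real.cos α : ℂ) * (Complex.sin w / Complex.sin (α - w)) +
      (Complex.sin w / Complex.sin (α - w)) ^ 2 =
      (Real.sin α : ℂ) ^ 2 / Complex.sin (α - w) ^ 2 := by
  obtain ⟨e1, e2, -⟩ := sin_addition_expansion α w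
  rw [Complex.ofReal_cos, Complex.ofReal_sin, e1, e2]
  field_simp
  have e3 := Complex.sin_sq_add_cos_sq w
  have e4 := Complex.sin_sq_add_cos_sq (α - w)
  linear_combination -Complex.sin (α - w) ^ 2 * e3 - Complex.sin w ^ 2 * e4

/-- Written through the quadratic so that it cancels the denominator of the derivative of
`stripMap`. -/
theorem hasDerivAt_sin_div_sin_sub (hα : Real.sin α ≠ 0) (h : Complex.sin (α - w) ≠ 0) :
    HasDerivAt (fun w => Complex.sin w / Complex.sin (α - w))
      ((1 + 2 * (Real.cos α : ℂ) * (Complex.sin w / Complex.sin (α - w)) +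
        (Complex.sin w / Complex.sin (α - w)) ^ 2) / (Real.sin α : ℂ)) w := by
  have hs : (Real.sin α : ℂ) ≠ 0 := by exact_mod_cast hα
  have h1 : HasDerivAt (fun w => Complex.sin (α - w)) (-Complex.cos (α - w)) w := by
    have := (Complex.hasDerivAt_sin (α - w)).comp w ((hasDerivAt_id w).const_sub (α : ℂ))
    rw [mul_neg_one] at this
    exact this
  convert! (Complex.hasDerivAt_sin w).div h1 h using 1
  rw [quadratic_sin_div_sin_sub h]
  obtain ⟨e1, -, -⟩ := sin_addition_expansion α w
  rw [← Complex.ofReal_sin] at e1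
  field_simp
  linear_combination e1

theorem one_sub_sq_div_quadratic (hα : Real.sin α ≠ 0) (h : Complex.sin (α - w) ≠ 0) :
    (1 - (Complex.sin w / Complex.sin (α - w)) ^ 2) /
      (1 + 2 * (Real.cos α : ℂ) * (Complex.sin w / Complex.sin (α - w)) +
        (Complex.sin w / Complex.sin (α - w)) ^ 2) =
      Complex.sin (α - 2 * w) / (Real.sin α : ℂ) := by
  have hs : (Real.sin α : ℂ) ≠ 0 := by exact_mod_cast hα
  rw [quadratic_sin_div_sin_sub h]
  obtain ⟨e1, -, e3⟩ := sin_addition_expansion α w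
  rw [← Complex.ofReal_sin] at e1
  rw [e3]
  field_simp
  rw [e1]
  have e3 := Complex.sin_sq_add_cos_sq w
  have e4 := Complex.sin_sq_add_cos_sq (α - w)
  linear_combination -Complex.sin (α - w) ^ 2 * e3 + Complex.sin w ^ 2 * e4

theorem sin_re_le_re_sin_sub_two_mul (hw : w.re ∈ Set.Ioo ((α - Real.pi) / 2) (α / 2)) :
    Real.sin (α - 2 * w.re) ≤ (Complex.sin (α - 2 * w)).re := by
  have : (Complex.sin (α - 2 * w)).re = Real.sin (α - 2 * w.re) * Real.cosh (2 * w.im) := by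
    rw [sin_eq_ofReal_add_ofReal_mul_I, Complex.add_re, Complex.ofReal_re, Complex.re_ofReal_mul]
    simp
  rw [this]
  exact le_mul_of_one_le_right (sin_sub_two_mul_pos hw).le (Real.one_le_cosh _)

theorem exists_sin_div_sin_sub_eq (hα₀ : 0 < α) (hα₁ : α < Real.pi) {z : ℂ} (hz : ‖z‖ < 1) :
    ∃ w : ℂ, w.re ∈ Set.Ioo ((α - Real.pi) / 2) (α / 2) ∧
      Complex.sin w / Complex.sin (α - w) = z := by
  have hα : 0 < Real.sin α := Real.sin_pos_of_pos_of_lt_pi hα₀ hα₁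
  have hs : (Real.sin α : ℂ) ≠ 0 := by exact_mod_cast hα.ne'
  have hA := one_add_ne_zero_of_norm_lt_one (z := z * Complex.exp (Complex.I * α))
    (by rwa [norm_mul_exp_I])
  have hB := one_add_ne_zero_of_norm_lt_one (z := z * Complex.exp (-(Complex.I * α)))
    (by rwa [norm_mul_exp_neg_I])
  have hslit := strip_quotient_mem_slitPlane α hz
  set e := Complex.exp (Complex.I * α) with he
  set e' := Complex.exp (-(Complex.I * α)) with he'
  set ρ := (1 + z * e) / (1 + z * e') with hρ
  have hee : e * e' = 1 := exp_I_mul_mul_exp_neg α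
  -- In exponentials, `sin w = z sin (α - w)` becomes linear in `e^{2iw}`, with solution `ρ`.
  set w : ℂ := Complex.log ρ / (2 * Complex.I) with hw
  have hwre : w.re = Complex.arg ρ / 2 := by
    have : w = -Complex.I * Complex.log ρ / 2 := by
      rw [hw]; field_simp; rw [Complex.I_sq]; ring
    rw [this]
    simp [Complex.log_im]
  set E := Complex.exp (w * Complex.I) with hE
  set E' := Complex.exp (-(w * Complex.I)) with hE'
  have hEE : E * E' = 1 := by rw [← Complex.exp_add]; simp
  have hE2 : E ^ 2 = ρ := by
    rw [hE, ← Complex.exp_nat_mul]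
    have : ((2 : ℕ) : ℂ) * (w * Complex.I) = Complex.log ρ := by
      rw [hw]; push_cast; field_simp
    rw [this, Complex.exp_log (Complex.slitPlane_ne_zero hslit)]
  have hE2' : E ^ 2 * (1 + z * e') = 1 + z * e := by rw [hE2, hρ]; field_simp
  have hsinw : Complex.sin w = (E' - E) * Complex.I / 2 := by
    rw [Complex.sin, neg_mul]
  have hsinα : Complex.sin (α - w) = (e' * E - e * E') * Complex.I / 2 := by
    rw [Complex.sin, he, he', hE, hE', ← Complex.exp_add, ← Complex.exp_add]
    ring_nf
  have hprod : Complex.sin w = z * Complex.sin (α - w) := by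
    rw [hsinw, hsinα]
    have hE0 : E ≠ 0 := Complex.exp_ne_zero _
    refine mul_left_cancel₀ hE0 ?_
    linear_combination (Complex.I / 2) * (1 + z * e) * hEE - (Complex.I / 2) * hE2'
  have hne : Complex.sin (α - w) ≠ 0 := by
    intro h0
    rw [h0, mul_zero] at hprod
    obtain ⟨e1, -, -⟩ := sin_addition_expansion α w
    rw [hprod, h0, ← Complex.ofReal_sin] at e1
    exact hs (by simpa using e1)
  have hlt : Complex.normSq (Complex.sin w) < Complex.normSq (Complex.sin (α - w)) := by
    rw [hprod, Complex.normSq_mul, Complex.normSq_eq_norm_sq z]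
    have := Complex.normSq_pos.2 hne
    have : ‖z‖ ^ 2 < 1 := by nlinarith [norm_nonneg z]
    nlinarith
  have hsin : 0 < Real.sin (α - 2 * w.re) := by
    have := normSq_sin_sub α w
    exact pos_of_mul_pos_right (a := Real.sin α) (by linarith) hα.le
  have harg := Complex.neg_pi_lt_arg ρ
  have harg' := Complex.arg_le_pi ρ
  have h2w : 2 * w.re = Complex.arg ρ := by rw [hwre]; ring
  refine ⟨w, ⟨?_, ?_⟩, by rw [hprod]; field_simp⟩
  -- Since `2 Re w = arg ρ`, the number `α - 2 Re w` lies in `(-π, 2π)`, where the sine is positive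
  -- only on `(0, π)`.
  · by_contra! hcon
    have := Real.sin_nonneg_of_nonneg_of_le_pi (x := α - 2 * w.re - Real.pi)
      (by linarith) (by linarith)
    rw [Real.sin_sub_pi] at this
    linarith
  · by_contra! hcon
    have := Real.sin_nonpos_of_nonpos_of_neg_pi_le (x := α - 2 * w.re)
      (by linarith) (by linarith)
    linarith

end Parametrization

/-! ### Derivatives of the convolution -/

/-- The common denominator `(1 + z)(1 + 2cz + z²)` of the derivatives of the two parts of the
sheared strip map. -/
noncomputable def shearDenom (c : ℝ) (z : ℂ) : ℂ := (1 + z) * (1 + 2 * (c : ℂ) * z + z ^ 2)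

theorem hasDerivAt_shearDenom (c : ℝ) (z : ℂ) :
    HasDerivAt (shearDenom c)
      (1 + 2 * (c : ℂ) * z + z ^ 2 + (1 + z) * (2 * (c : ℂ) + 2 * z)) z := by
  have h1 : HasDerivAt (fun z : ℂ => 1 + z) 1 z := (hasDerivAt_id z).const_add 1
  have h2 : HasDerivAt (fun z : ℂ => 1 + 2 * (c : ℂ) * z + z ^ 2) (2 * (c : ℂ) + 2 * z) z := by
    have := (((hasDerivAt_id z).const_mul (2 * (c : ℂ))).const_add 1).add (hasDerivAt_pow 2 z)
    convert! this using 1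
    simp
  convert! h1.mul h2 using 1
  ring

/-- The numerator of the derivative of the analytic part of the convolution. -/
noncomputable def convNumH (a k : ℝ) (z : ℂ) : ℂ :=
  2 + (k + 3 * a) * z + 2 * a * k * z ^ 2 + (a * k - 1) * z ^ 3

/-- Up to a factor `-z`, the numerator of the derivative of the co-analytic part of the
convolution. -/
noncomputable def convNumG (a k : ℝ) (z : ℂ) : ℂ :=
  (1 - a * k) - 2 * a * k * z - (k + 3 * a) * z ^ 2 - 2 * z ^ 3

section Sheared

variable {α a : ℝ} {h g : ℂ → ℂ}

theorem shearDenom_ne_zero (α : ℝ) {z : ℂ} (hz : z ∈ unitDisk) :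
    shearDenom (Real.cos α) z ≠ 0 :=
  have hz' := norm_lt_one_of_mem_unitDisk hz
  mul_ne_zero (one_add_ne_zero_of_norm_lt_one hz') (quadratic_ne_zero α hz')

theorem one_add_ofReal_mul_ne_zero (ha : 0 ≤ a) (ha' : a < 1) {z : ℂ} (hz : z ∈ unitDisk) :
    1 + (a : ℂ) * z ≠ 0 := by
  refine one_add_ne_zero_of_norm_lt_one ?_
  rw [norm_mul, Complex.norm_real, Real.norm_of_nonneg ha]
  nlinarith [norm_lt_one_of_mem_unitDisk hz, norm_nonneg z]

theorem one_add_ofReal_ne_zero (ha : 0 ≤ a) : (1 : ℂ) + a ≠ 0 := by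
  exact_mod_cast (by positivity : (1 + a : ℝ) ≠ 0)

theorem unitDisk_mem_nhds {z : ℂ} (hz : z ∈ unitDisk) : unitDisk ∈ nhds z :=
  Metric.isOpen_ball.mem_nhds hz

/-- The derivative of `h + g = stripMap α` and the dilatation form a linear system for `h'` and
`g'`. -/
theorem deriv_sheared (hα : Real.sin α ≠ 0) (ha : 0 ≤ a) (ha' : a < 1)
    (hh : DifferentiableOn ℂ h unitDisk) (hg : DifferentiableOn ℂ g unitDisk)
    (h_add_g : ∀ z ∈ unitDisk, h z + g z = stripMap α z)
    (dilatation : ∀ z ∈ unitDisk,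
      deriv g z = (z + (a : ℂ)) / (1 + (a : ℂ) * z) * deriv h z) {z : ℂ} (hz : z ∈ unitDisk) :
    deriv h z = (1 + a * z) / ((1 + a) * shearDenom (Real.cos α) z) ∧
      deriv g z = (z + a) / ((1 + a) * shearDenom (Real.cos α) z) := by
  have hz' := norm_lt_one_of_mem_unitDisk hz
  have hdh := (hh.differentiableAt (unitDisk_mem_nhds hz)).hasDerivAt
  have hdg := (hg.differentiableAt (unitDisk_mem_nhds hz)).hasDerivAt
  have hsum := (hdh.add hdg).unique ((hasDerivAt_stripMap hα hz').congr_of_eventuallyEq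
    (by filter_upwards [unitDisk_mem_nhds hz] with u hu using h_add_g u hu))
  have h1 := one_add_ne_zero_of_norm_lt_one hz'
  have h2 := quadratic_ne_zero α hz'
  have h3 := one_add_ofReal_mul_ne_zero ha ha' hz
  have h4 := one_add_ofReal_ne_zero ha
  have key : deriv h z = (1 + a * z) / ((1 + a) * shearDenom (Real.cos α) z) := by
    rw [dilatation z hz, eq_div_iff h2] at hsum
    rw [shearDenom, eq_div_iff (mul_ne_zero h4 (mul_ne_zero h1 h2))]
    have h5 : (1 + a * z) * ((z + a) / (1 + a * z)) = z + a := mul_div_cancel₀ _ h3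
    linear_combination (1 + a * z) * hsum -
      deriv h z * (1 + 2 * (Real.cos α : ℂ) * z + z ^ 2) * h5
  refine ⟨key, ?_⟩
  rw [dilatation z hz, key, div_mul_div_cancel₀ h3]

/-- Derivatives of the analytic and co-analytic parts of the convolution. -/
theorem hasDerivAt_conv_parts (hα : Real.sin α ≠ 0) (ha : 0 ≤ a) (ha' : a < 1)
    (hh : DifferentiableOn ℂ h unitDisk) (hg : DifferentiableOn ℂ g unitDisk)
    (h_add_g : ∀ z ∈ unitDisk, h z + g z = stripMap α z)
    (dilatation : ∀ z ∈ unitDisk,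
      deriv g z = (z + (a : ℂ)) / (1 + (a : ℂ) * z) * deriv h z) {z : ℂ} (hz : z ∈ unitDisk) :
    HasDerivAt (fun z => (h z + z * deriv h z) / 2)
      (convNumH a (2 * Real.cos α + 1) z / (2 * (1 + a) * shearDenom (Real.cos α) z ^ 2)) z ∧
    HasDerivAt (fun z => (g z - z * deriv g z) / 2)
      (-(z * convNumG a (2 * Real.cos α + 1) z) /
        (2 * (1 + a) * shearDenom (Real.cos α) z ^ 2)) z := by
  have hd := fun u (hu : u ∈ unitDisk) => deriv_sheared hα ha ha' hh hg h_add_g dilatation hu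
  have hdh := (hh.differentiableAt (unitDisk_mem_nhds hz)).hasDerivAt
  have hdg := (hg.differentiableAt (unitDisk_mem_nhds hz)).hasDerivAt
  have h4 := one_add_ofReal_ne_zero ha
  have hD := shearDenom_ne_zero α hz
  have hden := (hasDerivAt_shearDenom (Real.cos α) z).const_mul (1 + (a : ℂ))
  have hnumH : HasDerivAt (fun z : ℂ => 1 + (a : ℂ) * z) a z := by
    simpa using ((hasDerivAt_id z).const_mul (a : ℂ)).const_add 1
  have hnumG : HasDerivAt (fun z : ℂ => z + (a : ℂ)) 1 z := (hasDerivAt_id z).add_const _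
  have h2h := (hnumH.div hden (mul_ne_zero h4 hD)).congr_of_eventuallyEq (f₁ := deriv h)
    (by filter_upwards [unitDisk_mem_nhds hz] with u hu using (hd u hu).1)
  have h2g := (hnumG.div hden (mul_ne_zero h4 hD)).congr_of_eventuallyEq (f₁ := deriv g)
    (by filter_upwards [unitDisk_mem_nhds hz] with u hu using (hd u hu).2)
  have hDdef : shearDenom (Real.cos α) z =
    (1 + z) * (1 + 2 * (Real.cos α : ℂ) * z + z ^ 2) := rfl
  constructor
  · convert! (hdh.add ((hasDerivAt_id z).mul h2h)).div_const 2 using 1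
    rw [(hd z hz).1, convNumH]
    simp only [id]
    simp only [Complex.ofReal_add, Complex.ofReal_mul, Complex.ofReal_one, Complex.ofReal_ofNat]
    field_simp
    rw [hDdef]
    ring
  · convert! (hdg.sub ((hasDerivAt_id z).mul h2g)).div_const 2 using 1
    rw [(hd z hz).2, convNumG]
    simp only [id]
    simp only [Complex.ofReal_add, Complex.ofReal_mul, Complex.ofReal_one, Complex.ofReal_ofNat]
    field_simp
    rw [hDdef]
    ring

end Sheared

theorem norm_convNum_lt {a k : ℝ} (ha : 0 ≤ a) (ha' : a < 1) (hk : -1 < k) (hk' : k ≤ 1) {z E : ℂ}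
    (hz : z ∈ unitDisk) (hE : E ≠ 0) :
    ‖-(z * convNumG a k z) / E‖ < ‖convNumH a k z / E‖ := by
  rw [norm_div, norm_div, norm_neg]
  exact div_lt_div_of_pos_right
    (norm_mul_reversed_cubic_lt ha ha' hk hk' (norm_lt_one_of_mem_unitDisk hz))
    (norm_pos_iff.2 hE)

/-- With `q` the quadratic, `2(H - G)' = (h' - g') + (z (h' + g'))'`, where `h' + g' = 1/q` and `h'
- g' = (1-a)/(1+a) · (1-z)/(1+z) / q`. Also `(z/q)' = (1 - z²)/q²`; the factor `q / sin α` is `ψ'`.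
-/
theorem convNum_sub_mul {α a : ℝ} (hα : Real.sin α ≠ 0) (ha : 0 ≤ a) {z : ℂ}
    (hz : z ∈ unitDisk) :
    (convNumH a (2 * Real.cos α + 1) z / (2 * (1 + a) * shearDenom (Real.cos α) z ^ 2) -
      -(z * convNumG a (2 * Real.cos α + 1) z) /
        (2 * (1 + a) * shearDenom (Real.cos α) z ^ 2)) *
      ((1 + 2 * (Real.cos α : ℂ) * z + z ^ 2) / (Real.sin α : ℂ)) =
    ((1 / (2 * Real.sin α) : ℝ) : ℂ) * (((1 - a) / (1 + a) : ℝ) * ((1 + -z) / (1 - -z)) +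
      (1 - z ^ 2) / (1 + 2 * (Real.cos α : ℂ) * z + z ^ 2)) := by
  have hz' := norm_lt_one_of_mem_unitDisk hz
  have hs : (Real.sin α : ℂ) ≠ 0 := by exact_mod_cast hα
  have h1 := one_add_ne_zero_of_norm_lt_one hz'
  have h2 := quadratic_ne_zero α hz'
  have h4 := one_add_ofReal_ne_zero ha
  simp only [convNumH, convNumG, shearDenom, Complex.ofReal_add, Complex.ofReal_mul,
    Complex.ofReal_one, Complex.ofReal_ofNat, Complex.ofReal_div, Complex.ofReal_sub,
    sub_neg_eq_add]
  generalize hq : 1 + 2 * (Real.cos α : ℂ) * z + z ^ 2 = q at h2 ⊢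
  field_simp
  rw [← hq]
  ring

/-! ### Assembly -/

theorem theorem6 (α a : ℝ) (hα : Real.pi / 2 ≤ α) (hα' : α < Real.pi) (ha : 0 ≤ a) (ha' : a < 1)
    (h g : ℂ → ℂ)
    (hh : DifferentiableOn ℂ h unitDisk) (hg : DifferentiableOn ℂ g unitDisk)
    (h_zero : h 0 = 0) (g_zero : g 0 = 0)
    (h_add_g : ∀ z ∈ unitDisk, h z + g z = stripMap α z)
    (dilatation : ∀ z ∈ unitDisk,
      deriv g z = (z + (a : ℂ)) / (1 + (a : ℂ) * z) * deriv h z) :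
    IsSHO (fun z => (1 + (a : ℂ)) * harmonicConv canonicalH canonicalG h g z) ∧
      ConvexInRealDirection (harmonicConv canonicalH canonicalG h g '' unitDisk) := by
  have hα₀ : 0 < α := lt_of_lt_of_le (by positivity) hα
  have hsin : 0 < Real.sin α := Real.sin_pos_of_pos_of_lt_pi hα₀ hα'
  have hcos : Real.cos α ≤ 0 :=
    Real.cos_nonpos_of_pi_div_two_le_of_le hα (by linarith [Real.pi_pos])
  have hcos' : -1 < Real.cos α := by nlinarith [Real.sin_sq_add_cos_sq α, sq_pos_of_pos hsin]
  -- The range `π/2 ≤ α < π` is what places `k` in the Schur–Cohn range `(-1, 1]`.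
  have hk : -1 < 2 * Real.cos α + 1 := by linarith
  have hk' : 2 * Real.cos α + 1 ≤ 1 := by linarith
  have h1a := one_add_ofReal_ne_zero ha
  have hden : ∀ z ∈ unitDisk, 2 * (1 + (a : ℂ)) * shearDenom (Real.cos α) z ^ 2 ≠ 0 :=
    fun z hz => mul_ne_zero (mul_ne_zero two_ne_zero h1a) (pow_ne_zero 2 (shearDenom_ne_zero α hz))
  have hparts := fun z (hz : z ∈ unitDisk) =>
    hasDerivAt_conv_parts hsin.ne' ha ha' hh hg h_add_g dilatation hz
  set H : ℂ → ℂ := fun z => (h z + z * deriv h z) / 2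
  set G : ℂ → ℂ := fun z => (g z - z * deriv g z) / 2
  have hconv : ∀ z ∈ unitDisk, harmonicConv canonicalH canonicalG h g z =
      H z + conj (G z) := fun z hz => by
    rw [harmonicConv, analyticConv_canonicalH hh h_zero hz, analyticConv_canonicalG hg g_zero hz]
  set H' : ℂ → ℂ := fun z => convNumH a (2 * Real.cos α + 1) z /
    (2 * (1 + a) * shearDenom (Real.cos α) z ^ 2) with hH'
  set G' : ℂ → ℂ := fun z => -(z * convNumG a (2 * Real.cos α + 1) z) /
    (2 * (1 + a) * shearDenom (Real.cos α) z ^ 2) with hG'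
  have hHG : ∀ z ∈ unitDisk, ‖G' z‖ < ‖H' z‖ := fun z hz =>
    norm_convNum_lt ha ha' hk hk' hz (hden z hz)
  have hwirt := fun z (hz : z ∈ unitDisk) =>
    wirtinger_of_eventuallyEq (f := fun z => (1 + (a : ℂ)) *
      harmonicConv canonicalH canonicalG h g z) (κ := 1 + a) (hparts z hz).1 (hparts z hz).2
      (by filter_upwards [unitDisk_mem_nhds hz] with u hu; rw [hconv u hu])
  have h0 : (0 : ℂ) ∈ unitDisk := by simp [unitDisk]
  let ψ : ℂ → ℂ := fun w => Complex.sin w / Complex.sin (α - w)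
  have hψmem : ∀ w : ℂ, w.re ∈ Set.Ioo ((α - Real.pi) / 2) (α / 2) → ψ w ∈ unitDisk :=
    fun w hw => sin_div_sin_sub_mem_unitDisk hsin hw
  have hψimage : ψ '' (Complex.re ⁻¹' Set.Ioo ((α - Real.pi) / 2) (α / 2)) = unitDisk := by
    refine Set.Subset.antisymm (Set.image_subset_iff.2 fun w hw => hψmem w hw) fun z hz => ?_
    obtain ⟨w, hw, hwz⟩ := exists_sin_div_sin_sub_eq hα₀ hα' (norm_lt_one_of_mem_unitDisk hz)
    exact ⟨w, hw, hwz⟩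
  have hψderiv : ∀ w : ℂ, w.re ∈ Set.Ioo ((α - Real.pi) / 2) (α / 2) →
      HasDerivAt ψ ((1 + 2 * (Real.cos α : ℂ) * ψ w + ψ w ^ 2) / (Real.sin α : ℂ)) w :=
    fun w hw => hasDerivAt_sin_div_sin_sub hsin.ne' (sin_sub_ne_zero hsin hw)
  have hψne : ∀ w : ℂ, w.re ∈ Set.Ioo ((α - Real.pi) / 2) (α / 2) →
      (1 + 2 * (Real.cos α : ℂ) * ψ w + ψ w ^ 2) / (Real.sin α : ℂ) ≠ 0 := fun w hw =>
    div_ne_zero (quadratic_ne_zero α (norm_lt_one_of_mem_unitDisk (hψmem w hw)))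
      (by exact_mod_cast hsin.ne')
  obtain ⟨hinj, hconvex⟩ := shear_strip (x₁ := (α - Real.pi) / 2) (x₂ := α / 2)
    (P := fun w => H (ψ w) - G (ψ w)) (Q := fun w => H (ψ w) + G (ψ w))
    (P' := fun w => (H' (ψ w) - G' (ψ w)) *
      ((1 + 2 * (Real.cos α : ℂ) * ψ w + ψ w ^ 2) / (Real.sin α : ℂ)))
    (Q' := fun w => (H' (ψ w) + G' (ψ w)) *
      ((1 + 2 * (Real.cos α : ℂ) * ψ w + ψ w ^ 2) / (Real.sin α : ℂ)))
    (δ := fun x => 1 / (2 * Real.sin α) * (Real.sin (α - 2 * x) / Real.sin α))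
    (fun w hw => ((hparts _ (hψmem w hw)).1.sub (hparts _ (hψmem w hw)).2).comp w (hψderiv w hw))
    (fun w hw => ((hparts _ (hψmem w hw)).1.add (hparts _ (hψmem w hw)).2).comp w (hψderiv w hw))
    (fun x hx => by
      have := sin_sub_two_mul_pos (w := (x : ℂ)) (by simpa using hx)
      rw [Complex.ofReal_re] at this
      positivity)
    (fun w hw => by
      have hmem := hψmem w hw
      have hre : 0 ≤ ((1 + -ψ w) / (1 - -ψ w)).re := (re_add_div_sub_pos (A := 1) (B := -ψ w)
        (by simpa using norm_lt_one_of_mem_unitDisk hmem)).le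
      have hb : 0 ≤ (1 - a) / (1 + a) := div_nonneg (by linarith) (by linarith)
      simp only [hH', hG']
      rw [convNum_sub_mul hsin.ne' ha hmem, Complex.re_ofReal_mul, Complex.add_re,
        Complex.re_ofReal_mul,
        one_sub_sq_div_quadratic hsin.ne' (sin_sub_ne_zero hsin hw), Complex.div_ofReal_re]
      have hle := div_le_div_of_nonneg_right (sin_re_le_re_sin_sub_two_mul hw) hsin.le
      have := mul_nonneg hb hre
      gcongr
      linarith)
    (fun w hw => by
      -- The factor `ψ'` cancels, leaving `(H' + G')/(H' - G')`, the Cayley transform of the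
      -- dilatation.
      rw [mul_div_mul_right _ _ (hψne w hw)]
      exact re_add_div_sub_pos (hHG _ (hψmem w hw)))
  have hcomp : ∀ w ∈ Complex.re ⁻¹' Set.Ioo ((α - Real.pi) / 2) (α / 2),
      (⟨(H (ψ w) + G (ψ w)).re, (H (ψ w) - G (ψ w)).im⟩ : ℂ) =
        harmonicConv canonicalH canonicalG h g (ψ w) := fun w hw => by
    rw [hconv _ (hψmem w hw)]
    apply Complex.ext <;> simp [sub_eq_add_neg]
  constructor
  · refine ⟨fun z hz => ?_, fun z hz => ?_, ?_, ?_, ?_, ?_⟩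
    · have hHa : AnalyticAt ℂ H z := DifferentiableOn.analyticAt (s := unitDisk)
        (fun u hu => (hparts u hu).1.differentiableAt.differentiableWithinAt)
        (unitDisk_mem_nhds hz)
      have hGa : AnalyticAt ℂ G z := DifferentiableOn.analyticAt (s := unitDisk)
        (fun u hu => (hparts u hu).2.differentiableAt.differentiableWithinAt)
        (unitDisk_mem_nhds hz)
      refine (InnerProductSpace.harmonicAt_congr_nhds ?_).2
        ((hHa.harmonicAt.add hGa.harmonicAt_conj).const_smul (c := 1 + a))
      filter_upwards [unitDisk_mem_nhds hz] with u hu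
      rw [hconv u hu]
      simp [mul_add]
    · rw [(hwirt z hz).1, (hwirt z hz).2, norm_mul, norm_mul, Complex.norm_conj]
      exact mul_lt_mul_of_pos_left (hHG z hz) (norm_pos_iff.2 h1a)
    · rw [← hψimage]
      rintro _ ⟨u, hu, rfl⟩ _ ⟨v, hv, rfl⟩ huv
      have huv' := mul_left_cancel₀ h1a huv
      rw [← hcomp u hu, ← hcomp v hv] at huv'
      rw [hinj hu hv huv']
    · simp [hconv 0 h0, H, G, h_zero, g_zero]
    -- `H' 0 = 1/(1 + a)`, which explains the normalizing factor `1 + a`.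
    · rw [(hwirt 0 h0).1]
      simp only [convNumH, shearDenom]
      field_simp
      simp
    · rw [(hwirt 0 h0).2]
      simp
  · have himg : harmonicConv canonicalH canonicalG h g '' unitDisk =
        (fun w => (⟨(H (ψ w) + G (ψ w)).re, (H (ψ w) - G (ψ w)).im⟩ : ℂ)) ''
          (Complex.re ⁻¹' Set.Ioo ((α - Real.pi) / 2) (α / 2)) := by
      rw [← hψimage, Set.image_image]
      exact Set.image_congr fun w hw => (hcomp w hw).symm
    rw [himg]
    exact hconvex
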